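/- All graphs are finite and simple. A graph is subcubic if every vertex has degree at most $3$. The exact square chromatic number $\chi^{[\sharp 2]}(G)$ of a graph $G$ is the least number of colors in a coloring of the vertices of $G$ in which any two vertices at distance exactly $2$ receive distinct colors (adjacent vertices may share a color). A graph is outerplanar if it can be drawn in the plane without crossings so that every vertex lies on the boundary of the outer (unbounded) face. Theorem. Every subcubic $K_4$-minor-free graph $G$ satisfies $\chi^{[\sharp 2]}(G)\le 4$. The bound is tight, both for bipartite graphs of girth at least $6$ and for outerplanar graphs: there is a bipartite subcubic $K_4$-minor-free graph $G$ of girth at least $6$ with $\chi^{[\sharp 2]}(G)=4$, and there is an outerplanar subcubic $K_4$-minor-free graph $G$ with $\chi^{[\sharp 2]}(G)=4$. -/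

import Mathlib

/-- The exact square of `G`: two vertices are joined when their distance in `G` is exactly `2`. -/
def SimpleGraph.exactSquare {V : Type*} (G : SimpleGraph V) : SimpleGraph V where
  Adj u v := G.dist u v = 2
  symm := ⟨fun u v h => by rw [SimpleGraph.dist_comm]; exact h⟩
  loopless := ⟨fun v h => by simp at h⟩

/-- The exact square chromatic number: the least number of colors in a vertex coloring in which
any two vertices at distance exactly `2` receive distinct colors. -/
noncomputable def SimpleGraph.exactSquareChromaticNumber {V : Type*} (G : SimpleGraph V) : ℕ∞ :=
  G.exactSquare.chromaticNumber

/-- Every vertex has degree at most `3`. -/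
def SimpleGraph.IsSubcubic {V : Type*} (G : SimpleGraph V) : Prop :=
  ∀ v : V, (G.neighborSet v).encard ≤ 3

/-- `H` is a minor of `G`: there are pairwise disjoint branch sets in `G`, one for each vertex of
`H`, each inducing a connected (hence nonempty) subgraph, such that adjacent vertices of `H` have
branch sets joined by at least one edge of `G`. -/
def SimpleGraph.IsMinorOf {W V : Type*} (H : SimpleGraph W) (G : SimpleGraph V) : Prop :=
  ∃ B : W → Set V,
    (∀ w, (G.induce (B w)).Connected) ∧
    (∀ w w', w ≠ w' → Disjoint (B w) (B w')) ∧
    ∀ w w', H.Adj w w' → ∃ x ∈ B w, ∃ y ∈ B w', G.Adj x y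

/-- The complete graph on four vertices is not a minor of `G`. -/
def SimpleGraph.IsK4MinorFree {V : Type*} (G : SimpleGraph V) : Prop :=
  ¬ (completeGraph (Fin 4)).IsMinorOf G

/-- A plane drawing of `G` without crossings: vertices are distinct points of the plane, edges are
simple arcs joining their ends, an edge contains no vertex other than its ends, and two distinct
edges meet at most in common ends. (The value of `arc` outside the edge set is irrelevant.) -/
structure SimpleGraph.PlaneDrawing {V : Type*} (G : SimpleGraph V) where
  pt : V → EuclideanSpace ℝ (Fin 2)
  arc : Sym2 V → Set (EuclideanSpace ℝ (Fin 2))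
  pt_injective : Function.Injective pt
  arc_eq_range : ∀ u v, G.Adj u v →
    ∃ γ : _root_.Path (pt u) (pt v), Function.Injective γ ∧ Set.range γ = arc s(u, v)
  mem_of_pt_mem_arc : ∀ e ∈ G.edgeSet, ∀ v, pt v ∈ arc e → v ∈ e
  arc_inter_arc : ∀ e ∈ G.edgeSet, ∀ e' ∈ G.edgeSet, e ≠ e' →
    arc e ∩ arc e' ⊆ pt '' {v | v ∈ e ∧ v ∈ e'}

/-- The point set of the plane covered by the drawing. -/
def SimpleGraph.PlaneDrawing.support {V : Type*} {G : SimpleGraph V} (D : G.PlaneDrawing) :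
    Set (EuclideanSpace ℝ (Fin 2)) :=
  Set.range D.pt ∪ ⋃ e ∈ G.edgeSet, D.arc e

/-- A face of the drawing is a connected component of the complement of the drawing. -/
def SimpleGraph.PlaneDrawing.IsFace {V : Type*} {G : SimpleGraph V} (D : G.PlaneDrawing)
    (F : Set (EuclideanSpace ℝ (Fin 2))) : Prop :=
  ∃ x ∈ D.supportᶜ, F = connectedComponentIn D.supportᶜ x

/-- `G` is outerplanar: it has a plane drawing without crossings in which every vertex lies on the
boundary of the outer (unbounded) face. -/
def SimpleGraph.IsOuterplanar {V : Type*} (G : SimpleGraph V) : Prop :=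
  ∃ (D : G.PlaneDrawing) (F : Set (EuclideanSpace ℝ (Fin 2))),
    D.IsFace F ∧ ¬ Bornology.IsBounded F ∧ ∀ v, D.pt v ∈ frontier F

namespace SimpleGraph

variable {V W : Type*} {G : SimpleGraph V}

/-! The upper bound is proved by induction on the edge set. A small set `T` of vertices is stripped
of its edges, the rest is coloured, and the vertices of `T` are recoloured greedily. This works if
each vertex of `T` has at most three vertices at distance two, and if every pair outside `T` that
was at distance two through `T` still has a common neighbour outside `T`
(`colorable_exactSquare_of_isolate`).

Such a `T` always exists. If no vertex has degree one, `IsK4MinorFree.exists_hasTwoNeighbors` gives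
a vertex of degree two lying on a triangle, lying on a 4-cycle, or adjacent to another vertex of
degree two. Otherwise, contracting each vertex of degree two into a neighbour would leave a graph
with an edge whose non-isolated vertices all have at least three neighbours. Such a graph has a `K₄`
minor, found along a longest path.

For tightness, one example has a `K₄` in its exact square; in the other, three colours are refuted
by forced equalities between colours. Absence of `K₄` minors is certified by an elimination
ordering, and outerplanarity by a drawing with chords of a parabola. -/

theorem connected_induce_list {l : List V} (hne : l ≠ []) (h : l.IsChain G.Adj) :
    (G.induce {x | x ∈ l}).Connected := by
  have := (Walk.ofSupport l hne h).connected_induce_support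
  rwa [Walk.support_ofSupport] at this

theorem completeGraph_four_isMinorOf {A B C D : Set V}
    (hA : (G.induce A).Connected) (hB : (G.induce B).Connected)
    (hC : (G.induce C).Connected) (hD : (G.induce D).Connected)
    (dAB : Disjoint A B) (dAC : Disjoint A C) (dAD : Disjoint A D)
    (dBC : Disjoint B C) (dBD : Disjoint B D) (dCD : Disjoint C D)
    (eAB : ∃ x ∈ A, ∃ y ∈ B, G.Adj x y) (eAC : ∃ x ∈ A, ∃ y ∈ C, G.Adj x y)
    (eAD : ∃ x ∈ A, ∃ y ∈ D, G.Adj x y) (eBC : ∃ x ∈ B, ∃ y ∈ C, G.Adj x y)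
    (eBD : ∃ x ∈ B, ∃ y ∈ D, G.Adj x y) (eCD : ∃ x ∈ C, ∃ y ∈ D, G.Adj x y) :
    (completeGraph (Fin 4)).IsMinorOf G := by
  have sw : ∀ {S T : Set V}, (∃ x ∈ S, ∃ y ∈ T, G.Adj x y) → ∃ x ∈ T, ∃ y ∈ S, G.Adj x y :=
    fun ⟨x, hx, y, hy, h⟩ => ⟨y, hy, x, hx, h.symm⟩
  refine ⟨![A, B, C, D], ?_, ?_, ?_⟩
  · intro w
    fin_cases w <;> assumption
  · intro w w' h
    fin_cases w <;> fin_cases w' <;>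
      first | exact absurd rfl h | assumption | (apply Disjoint.symm; assumption)
  · intro w w' h
    fin_cases w <;> fin_cases w' <;>
      first | exact absurd rfl h.ne | assumption | (apply sw; assumption)

/-! ### A `K₄` minor from three neighbours at every non-isolated vertex -/

/-- `A ++ C` is a longest path of `G`, and the first vertex of `A` is joined to the first vertex
of `C`, so that the vertices of `A` and the first one of `C` form a cycle. -/
structure IsLasso (G : SimpleGraph V) (A C : List V) : Prop where
  chain : (A ++ C).IsChain G.Adj
  nodup : (A ++ C).Nodup
  longest : ∀ l : List V, l.IsChain G.Adj → l.Nodup → l.length ≤ (A ++ C).length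
  two_le : 2 ≤ A.length
  adj : ∃ a ∈ A.head?, ∃ c ∈ C.head?, G.Adj a c

/-- The cycle can be traversed the other way: the path may enter `C` from the first vertex of `A`
instead of the last. This symmetry transfers statements about one end of `A` to the other. -/
theorem IsLasso.reverse {A C : List V} (h : G.IsLasso A C) : G.IsLasso A.reverse C := by
  obtain ⟨a, ha, c, hc, hac⟩ := h.adj
  have hch := List.isChain_append.1 h.chain
  have hA : A ≠ [] := by rintro rfl; simp at ha
  refine ⟨?_, ?_, ?_, by simpa using h.two_le, A.getLast hA, ?_, c, hc, ?_⟩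
  · refine List.isChain_append.2 ⟨?_, hch.2.1, ?_⟩
    · rw [List.isChain_reverse]
      exact hch.1.imp fun _ _ h => h.symm
    · intro x hx y hy
      simp only [List.getLast?_reverse] at hx
      rw [Option.mem_unique hx ha, Option.mem_unique hy hc]
      exact hac
  · have := h.nodup
    rw [List.nodup_append] at this ⊢
    simpa using this
  · simpa using h.longest
  · simp [List.getLast?_eq_getLast_of_ne_nil hA]
  · exact hch.2.2 _ (by simp [List.getLast?_eq_getLast_of_ne_nil hA]) c hc

/-- The first vertex has a neighbour other than its successor and the first vertex of `C`. Off the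
path, that neighbour would extend a longest path; inside `A`, it would close a shorter cycle. So it
lies beyond the cycle. -/
theorem IsLasso.exists_adj_tail {A C : List V} (h : G.IsLasso A C)
    (hmin : ∀ A' C', G.IsLasso A' C' → A.length ≤ A'.length)
    (hdeg : ∀ v a, G.Adj v a → ∀ p q, ∃ w, G.Adj v w ∧ w ≠ p ∧ w ≠ q) :
    ∃ a ∈ A.head?, ∃ w ∈ C.tail, G.Adj a w := by
  obtain ⟨hch, hnd, hlong, h2, a, ha, c, hc, hac⟩ := h
  obtain ⟨b, A, rfl⟩ : ∃ b A', A = a :: b :: A' := by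
    match A, h2, ha with
    | x :: y :: l, _, ha => simp at ha; subst ha; exact ⟨y, l, rfl⟩
  obtain ⟨C, rfl⟩ : ∃ C', C = c :: C' := by
    match C, hc with
    | x :: l, hc => simp at hc; subst hc; exact ⟨l, rfl⟩
  obtain ⟨w, haw, hwb, hwc⟩ := hdeg a c hac b c
  refine ⟨a, ha, w, ?_, haw⟩
  by_contra hwC
  simp only [List.tail_cons] at hwC
  by_cases hwA : w ∈ A
  · obtain ⟨X, Y, rfl⟩ := List.append_of_mem hwA
    have := hmin (a :: b :: X) (w :: Y ++ c :: C)
      ⟨by simpa using hch, by simpa using hnd, by simpa using hlong, by simp,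
        a, by simp, w, by simp, haw⟩
    simp at this
  · have := hlong (w :: (a :: b :: A ++ c :: C)) ?_ ?_
    · simp at this
    · exact List.isChain_cons.2 ⟨by simpa using haw.symm, hch⟩
    · refine List.nodup_cons.2 ⟨?_, hnd⟩
      simp [hwA, hwC, hwb, hwc, haw.ne']

/-- Both neighbours `a` and `z` of `c` on the cycle are joined to the tail of the path beyond `c`.
The branch sets are the cycle without `z` and `c`, the singletons `{z}` and `{c}`, and that tail. -/
theorem IsLasso.isMinorOf {A C : List V} (h : G.IsLasso A C)
    (hmin : ∀ A' C', G.IsLasso A' C' → A.length ≤ A'.length)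
    (hdeg : ∀ v a, G.Adj v a → ∀ p q, ∃ w, G.Adj v w ∧ w ≠ p ∧ w ≠ q) :
    (completeGraph (Fin 4)).IsMinorOf G := by
  obtain ⟨a, ha, w, hw, haw⟩ := h.exists_adj_tail hmin hdeg
  obtain ⟨z, hz, w', hw', hzw⟩ := h.reverse.exists_adj_tail (by simpa using hmin) hdeg
  obtain ⟨hch, hnd, -, h2, a', ha', c, hc, hac⟩ := h
  obtain rfl := Option.mem_unique ha ha'
  obtain ⟨A, rfl⟩ : ∃ A', A = A' ++ [z] := by
    obtain ⟨l, rfl⟩ : ∃ l, A = List.reverse l := ⟨A.reverse, by simp⟩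
    match l, hz with
    | x :: l, hz => simp at hz; subst hz; exact ⟨l.reverse, by simp⟩
  obtain ⟨C, rfl⟩ : ∃ C', C = c :: C' := by
    match C, hc with
    | x :: l, hc => simp at hc; subst hc; exact ⟨l, rfl⟩
  obtain ⟨A, rfl⟩ : ∃ A', A = a :: A' := by
    match A, h2, ha with
    | x :: l, _, ha => simp at ha; subst ha; exact ⟨l, rfl⟩
  simp only [List.tail_cons] at hw hw'
  obtain ⟨d, C, rfl⟩ : ∃ d C', C = d :: C' := by
    match C, hw with
    | x :: l, _ => exact ⟨x, l, rfl⟩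
  have hch' : (a :: A).IsChain G.Adj ∧ (∀ x ∈ (a :: A).getLast?, G.Adj x z) ∧ G.Adj z c ∧
      G.Adj c d ∧ (d :: C).IsChain G.Adj := by
    rw [List.append_assoc, List.isChain_append] at hch
    obtain ⟨h1, h3, h4⟩ := hch
    simp only [List.singleton_append, List.isChain_cons_cons] at h3
    refine ⟨h1, fun x hx => h4 x hx z (by simp), h3.1, h3.2.1, h3.2.2⟩
  obtain ⟨h1, h3, h4, h5, h6⟩ := hch'
  have hlast := List.getLast_mem (l := a :: A) (by simp)
  refine completeGraph_four_isMinorOf (A := {x | x ∈ a :: A}) (B := {x | x ∈ [z]})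
    (C := {x | x ∈ [c]}) (D := {x | x ∈ d :: C})
    (connected_induce_list (by simp) h1) (connected_induce_list (by simp) (by simp))
    (connected_induce_list (by simp) (by simp)) (connected_induce_list (by simp) h6)
    ?_ ?_ ?_ ?_ ?_ ?_
    ⟨_, hlast, z, by simp, h3 _ (by simp [List.getLast?_eq_getLast_of_ne_nil])⟩
    ⟨a, by simp, c, by simp, hac⟩ ⟨a, by simp, w, hw, haw⟩
    ⟨z, by simp, c, by simp, h4⟩ ⟨z, by simp, w', hw', hzw⟩ ⟨c, by simp, d, by simp, h5⟩ <;>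
  · rw [Set.disjoint_left]
    simp only [Set.mem_ofPred_eq]
    grind

/-- A finite graph with an edge, in which every non-isolated vertex has at least three
neighbors, has `K₄` as a minor. -/
theorem completeGraph_four_isMinorOf_of_three_neighbors [Finite V] {u v : V} (huv : G.Adj u v)
    (hdeg : ∀ v a, G.Adj v a → ∀ p q, ∃ w, G.Adj v w ∧ w ≠ p ∧ w ≠ q) :
    (completeGraph (Fin 4)).IsMinorOf G := by
  classical
  have := Fintype.ofFinite V
  obtain ⟨l, ⟨hch, hnd⟩, hlong⟩ : ∃ l ∈ {l : List V | l.IsChain G.Adj ∧ l.Nodup},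
      ∀ l' ∈ {l : List V | l.IsChain G.Adj ∧ l.Nodup}, l'.length ≤ l.length := by
    refine Set.exists_max_image _ _ ?_ ⟨[], by simp⟩
    refine (List.finite_length_le V (Fintype.card V)).subset fun l hl => ?_
    exact hl.2.length_le_card
  have h2 := hlong [u, v] ⟨by simpa using huv, by simpa using huv.ne⟩
  obtain ⟨a, b, l, rfl⟩ : ∃ a b l', l = a :: b :: l' := by
    match l, h2 with
    | x :: y :: l, _ => exact ⟨x, y, l, rfl⟩
  have hab : G.Adj a b := (List.isChain_cons_cons.1 hch).1
  obtain ⟨w, haw, hwb, -⟩ := hdeg a b hab b b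
  have hw : w ∈ l := by
    by_contra hw
    have := hlong (w :: a :: b :: l) ⟨List.isChain_cons_cons.2 ⟨haw.symm, hch⟩,
      List.nodup_cons.2 ⟨by simp [hw, hwb, haw.ne'], hnd⟩⟩
    simp at this
  obtain ⟨X, Y, rfl⟩ := List.append_of_mem hw
  have hex : ∃ n A C, G.IsLasso A C ∧ A.length = n :=
    ⟨_, a :: b :: X, w :: Y, ⟨by simpa using hch, by simpa using hnd,
      fun l h1 h2 => by simpa using hlong l ⟨h1, h2⟩, by simp, a, by simp, w, by simp, haw⟩, rfl⟩
  obtain ⟨A, C, hAC, hn⟩ := Nat.find_spec hex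
  exact hAC.isMinorOf (fun A' C' h' => hn ▸ Nat.find_min' hex ⟨A', C', h', rfl⟩) hdeg

/-- A `K₄` minor lifts along a contraction of stars. -/
theorem completeGraph_four_isMinorOf_of_contraction {H : SimpleGraph W} (f : V → W) (s : W → V)
    (hfs : ∀ a, f (s a) = a) (hs : ∀ x, x = s (f x) ∨ G.Adj x (s (f x)))
    (hH : ∀ a b, H.Adj a b → ∃ x y, f x = a ∧ f y = b ∧ G.Adj x y)
    (hm : (completeGraph (Fin 4)).IsMinorOf H) : (completeGraph (Fin 4)).IsMinorOf G := by
  obtain ⟨B, hc, hd, ha⟩ := hm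
  refine ⟨fun w => f ⁻¹' B w, fun w => ?_, fun w w' h => (hd w w' h).preimage f, ?_⟩
  · have hstar : ∀ (x : V) (hx : f x ∈ B w), (G.induce (f ⁻¹' B w)).Reachable
        ⟨x, hx⟩ ⟨s (f x), by simpa [hfs] using hx⟩ := by
      intro x hx
      rcases hs x with h | h
      · have : (⟨x, hx⟩ : f ⁻¹' B w) = ⟨s (f x), by simpa [hfs] using hx⟩ := Subtype.ext h
        rw [← this]
      · exact Adj.reachable (G := G.induce (f ⁻¹' B w)) h
    have hwalk : ∀ (a b : B w), (H.induce (B w)).Walk a b → (G.induce (f ⁻¹' B w)).Reachable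
        ⟨s a, by simp [hfs]⟩ ⟨s b, by simp [hfs]⟩ := by
      intro a b p
      induction p with
      | nil => exact Reachable.refl _
      | @cons a b c h p ih =>
        refine Reachable.trans ?_ ih
        obtain ⟨x, y, hx, hy, hxy⟩ := hH a b h
        have h1 := hstar x (by simp [hx])
        have h2 := hstar y (by simp [hy])
        simp only [hx] at h1
        simp only [hy] at h2
        refine (h1.symm.trans (Adj.reachable (G := G.induce (f ⁻¹' B w)) ?_)).trans h2
        exact hxy
    obtain ⟨⟨b, hb⟩⟩ := (hc w).nonempty
    refine (connected_iff _).2 ⟨?_, ⟨⟨s b, by simpa [hfs] using hb⟩⟩⟩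
    rintro ⟨x, hx⟩ ⟨y, hy⟩
    obtain ⟨p⟩ := (hc w).preconnected ⟨f x, hx⟩ ⟨f y, hy⟩
    exact ((hstar x hx).trans (hwalk _ _ p)).trans (hstar y hy).symm
  · intro w w' h
    obtain ⟨a, haw, b, hbw, hab⟩ := ha w w' h
    obtain ⟨x, y, rfl, rfl, hxy⟩ := hH a b hab
    exact ⟨x, haw, y, hbw, hxy⟩

theorem exactSquare_adj {u v : V} :
    G.exactSquare.Adj u v ↔ u ≠ v ∧ ¬ G.Adj u v ∧ ∃ w, G.Adj w u ∧ G.Adj w v := by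
  constructor
  · intro (h : G.dist u v = 2)
    have hr : G.Reachable u v := by
      by_contra hr
      simp [dist_eq_zero_of_not_reachable hr] at h
    refine ⟨?_, fun ha => ?_, ?_⟩
    · rintro rfl
      simp at h
    · simp [dist_eq_one_iff_adj.2 ha] at h
    · obtain ⟨p, hp⟩ := hr.exists_walk_length_eq_dist
      rw [h] at hp
      match p, hp with
      | .cons h1 (.cons h2 .nil), _ => exact ⟨_, h1.symm, h2⟩
  · rintro ⟨hne, hna, w, hu, hv⟩
    have hw : G.dist u v ≤ 2 := dist_le (.cons hu.symm (.cons hv .nil))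
    have hr : G.Reachable u v := ⟨.cons hu.symm (.cons hv .nil)⟩
    have h0 := hr.dist_eq_zero_iff.not.2 hne
    have h1 := (dist_eq_one_iff_adj (G := G) (u := u) (v := v)).not.2 hna
    change G.dist u v = 2
    omega

theorem IsK4MinorFree.mono {H : SimpleGraph V} (hle : H ≤ G) (hG : G.IsK4MinorFree) :
    H.IsK4MinorFree := by
  rintro ⟨B, hc, hd, ha⟩
  refine hG ⟨B, fun w => (hc w).mono (fun _ _ h => hle h), hd, fun w w' h => ?_⟩
  obtain ⟨x, hx, y, hy, hxy⟩ := ha w w' h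
  exact ⟨x, hx, y, hy, hle hxy⟩

theorem IsSubcubic.mono {H : SimpleGraph V} (hle : H ≤ G) (hG : G.IsSubcubic) :
    H.IsSubcubic := fun v => (Set.encard_le_encard fun _ h => hle h).trans (hG v)

/-! ### Unavoidable configurations at vertices of degree two -/

/-- `x` and `y` are distinct and are all the neighbors of `u`. -/
structure HasTwoNeighbors (G : SimpleGraph V) (u x y : V) : Prop where
  left : G.Adj u x
  right : G.Adj u y
  ne : x ≠ y
  eq_or_eq : ∀ w, G.Adj u w → w = x ∨ w = y

theorem HasTwoNeighbors.symm {u x y : V} (h : G.HasTwoNeighbors u x y) :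
    G.HasTwoNeighbors u y x :=
  ⟨h.right, h.left, h.ne.symm, fun w hw => (h.eq_or_eq w hw).symm⟩

theorem HasTwoNeighbors.exists_of_adj {u x y a : V} (h : G.HasTwoNeighbors u x y)
    (ha : G.Adj u a) : ∃ b, G.HasTwoNeighbors u a b := by
  rcases h.eq_or_eq a ha with rfl | rfl
  exacts [⟨_, h⟩, ⟨_, h.symm⟩]

/-- A `K₄`-minor-free graph with an edge and without vertices of degree one has a vertex of degree
two whose neighbors are adjacent, or have another common neighbor, or one of which has degree
two. -/
theorem IsK4MinorFree.exists_hasTwoNeighbors [Finite V] (hG : G.IsK4MinorFree) {u v : V}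
    (huv : G.Adj u v) (h1 : ∀ v a, G.Adj v a → ∃ w, G.Adj v w ∧ w ≠ a) :
    ∃ u x y, G.HasTwoNeighbors u x y ∧
      (G.Adj x y ∨ (∃ w, w ≠ u ∧ G.Adj x w ∧ G.Adj y w) ∨ ∃ z, G.HasTwoNeighbors x u z) := by
  classical
  by_contra hcon
  push Not at hcon
  -- The vertices that survive the contraction; by `hW`, both neighbours of a vertex of degree two
  -- survive.
  let W := {v : V // ∀ a b, ¬ G.HasTwoNeighbors v a b}
  have hW : ∀ {y a b}, G.HasTwoNeighbors y a b → ∀ c d, ¬ G.HasTwoNeighbors a c d := by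
    intro y a b h c d h'
    obtain ⟨z, hz⟩ := h'.exists_of_adj h.left.symm
    exact (hcon _ _ _ h).2.2 z hz
  have hf : ∀ x : V, ∃ t : W, x = t ∨ ∃ b, G.HasTwoNeighbors x t b := by
    intro x
    by_cases h : ∀ a b, ¬ G.HasTwoNeighbors x a b
    · exact ⟨⟨x, h⟩, Or.inl rfl⟩
    · push Not at h
      obtain ⟨a, b, h⟩ := h
      exact ⟨⟨a, hW h⟩, Or.inr ⟨b, h⟩⟩
  choose f hf using hf
  have hfW : ∀ a : W, f (a : V) = a := by
    intro a
    rcases hf a with h | ⟨b, h⟩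
    · exact Subtype.ext h.symm
    · exact absurd h (a.2 _ _)
  let H : SimpleGraph W :=
    { Adj := fun a b => a ≠ b ∧ ∃ x y : V, f x = a ∧ f y = b ∧ G.Adj x y
      symm := ⟨fun a b ⟨h, x, y, hx, hy, hxy⟩ => ⟨h.symm, y, x, hy, hx, hxy.symm⟩⟩
      loopless := ⟨fun a h => h.1 rfl⟩ }
  have hnb : ∀ (v : W) y, G.Adj v y → ∃ t : W, H.Adj v t ∧
      (y = t ∨ G.HasTwoNeighbors y v t) := by
    intro v y hvy
    by_cases h : ∀ a b, ¬ G.HasTwoNeighbors y a b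
    · refine ⟨⟨y, h⟩, ⟨?_, v, y, hfW v, hfW ⟨y, h⟩, hvy⟩, Or.inl rfl⟩
      rintro rfl
      exact hvy.ne rfl
    · push Not at h
      obtain ⟨a, b, h⟩ := h
      obtain ⟨b, h⟩ := h.exists_of_adj hvy.symm
      refine ⟨⟨b, hW h.symm⟩, ⟨?_, ?_⟩, Or.inr h⟩
      · intro hvb
        exact h.ne (congrArg Subtype.val hvb)
      · have hy : f y = v ∨ f y = ⟨b, hW h.symm⟩ := by
          rcases hf y with h' | ⟨c, h'⟩
          · exact absurd h (by rw [h']; exact (f y).2 _ _)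
          · rcases h.eq_or_eq _ h'.left with h'' | h''
            · exact Or.inl (Subtype.ext h'')
            · exact Or.inr (Subtype.ext h'')
        rcases hy with hy | hy
        · exact ⟨y, b, hy, hfW ⟨b, hW h.symm⟩, h.right⟩
        · exact ⟨v, y, hfW v, hy, hvy⟩
  -- Distinct neighbours of `v` lead to distinct neighbours in `H`: a coincidence would give one of
  -- the excluded triangles or 4-cycles. Hence contraction does not lower the number of neighbours.
  have hinj : ∀ (v : W) {y y' : V} {t t' : W}, G.Adj v y → G.Adj v y' →
      (y = t ∨ G.HasTwoNeighbors y v t) → (y' = t' ∨ G.HasTwoNeighbors y' v t') →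
      y ≠ y' → t ≠ t' := by
    rintro v y y' t t' hy hy' h h' hne rfl
    rcases h with h | h <;> rcases h' with h' | h'
    · exact hne (h.trans h'.symm)
    · exact (hcon _ _ _ h').1 (h ▸ hy)
    · exact (hcon _ _ _ h).1 (h' ▸ hy')
    · exact (hcon _ _ _ h).2.1 y' hne.symm h'.left.symm h'.right.symm
  have hdeg : ∀ v a, H.Adj v a → ∀ p q, ∃ w, H.Adj v w ∧ w ≠ p ∧ w ≠ q := by
    rintro v a ⟨-, x, y, hx, -, hxy⟩ p q
    obtain ⟨y₁, hy₁⟩ : ∃ z, G.Adj v z := by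
      rcases hf x with h | ⟨b, h⟩
      · rw [hx] at h
        exact ⟨y, h ▸ hxy⟩
      · rw [hx] at h
        exact ⟨x, h.left.symm⟩
    obtain ⟨y₂, hy₂, h21⟩ := h1 _ _ hy₁
    obtain ⟨y₃, hy₃, h31, h32⟩ : ∃ y₃, G.Adj v y₃ ∧ y₃ ≠ y₁ ∧ y₃ ≠ y₂ := by
      by_contra hno
      push Not at hno
      refine v.2 y₁ y₂ ⟨hy₁, hy₂, h21.symm, fun w hw => ?_⟩
      by_contra! hw'
      exact hw'.2 (hno w hw hw'.1)
    obtain ⟨t₁, ha₁, ht₁⟩ := hnb v y₁ hy₁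
    obtain ⟨t₂, ha₂, ht₂⟩ := hnb v y₂ hy₂
    obtain ⟨t₃, ha₃, ht₃⟩ := hnb v y₃ hy₃
    have e12 := hinj v hy₁ hy₂ ht₁ ht₂ h21.symm
    have e13 := hinj v hy₁ hy₃ ht₁ ht₃ h31.symm
    have e23 := hinj v hy₂ hy₃ ht₂ ht₃ h32.symm
    by_contra! hno
    have n₁ := hno t₁ ha₁
    have n₂ := hno t₂ ha₂
    have n₃ := hno t₃ ha₃
    by_cases p₁ : t₁ = p
    · exact e23 ((n₂ fun h => e12 (p₁.trans h.symm)).trans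
        (n₃ fun h => e13 (p₁.trans h.symm)).symm)
    · have q₁ := n₁ p₁
      have p₂ : t₂ = p := by_contra fun h => e12 (q₁.trans (n₂ h).symm)
      have p₃ : t₃ = p := by_contra fun h => e13 (q₁.trans (n₃ h).symm)
      exact e23 (p₂.trans p₃.symm)
  obtain ⟨v, b, hvb⟩ : ∃ v b, H.Adj v b := by
    obtain ⟨v, a, hva⟩ : ∃ (v : W) (a : V), G.Adj v a := by
      rcases hf u with h | ⟨b, h⟩
      · exact ⟨f u, v, h ▸ huv⟩
      · exact ⟨f u, u, h.left.symm⟩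
    obtain ⟨t, ht, -⟩ := hnb v a hva
    exact ⟨v, t, ht⟩
  refine hG (completeGraph_four_isMinorOf_of_contraction (H := H) f Subtype.val hfW (fun x => ?_)
    (fun a b h => h.2) (completeGraph_four_isMinorOf_of_three_neighbors hvb hdeg))
  rcases hf x with h | ⟨b, h⟩
  exacts [Or.inl h, Or.inr h.left]

/-! ### Extending colourings, and the upper bound -/

theorem IsSubcubic.exists_neighbors (hG : G.IsSubcubic) {x u : V} (h : G.Adj x u) :
    ∃ p q, ∀ w, G.Adj x w → w = u ∨ w = p ∨ w = q := by
  by_contra! hno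
  obtain ⟨p, hp, hpu, -, -⟩ := hno u u
  obtain ⟨q, hq, hqu, hqp, -⟩ := hno p p
  obtain ⟨r, hr, hru, hrp, hrq⟩ := hno p q
  have hsub : ({u, p, q, r} : Set V) ⊆ G.neighborSet x := by
    rintro w (rfl | rfl | rfl | rfl) <;> assumption
  have := (Set.encard_le_encard hsub).trans (hG x)
  rw [Set.encard_insert_of_notMem (by simp [hpu.symm, hqu.symm, hru.symm]),
    Set.encard_insert_of_notMem (by simp [hqp.symm, hrp.symm]),
    Set.encard_pair hrq.symm] at this
  norm_num at this

theorem IsSubcubic.exists_third_neighbor (hG : G.IsSubcubic) {x u v : V} (h : G.Adj x u)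
    (h' : G.Adj x v) (hne : v ≠ u) : ∃ p, ∀ w, G.Adj x w → w = u ∨ w = v ∨ w = p := by
  obtain ⟨p, q, hpq⟩ := hG.exists_neighbors h
  rcases hpq v h' with rfl | rfl | rfl
  · exact absurd rfl hne
  · exact ⟨q, hpq⟩
  · exact ⟨p, fun w hw => by have := hpq w hw; tauto⟩

theorem exists_coloring_of_coloring_compl {X : SimpleGraph V} (T : Finset V)
    (hT : ∀ u ∈ T, ∃ p q r, ∀ w, X.Adj u w → w = p ∨ w = q ∨ w = r)
    (hc : ∃ c : V → Fin 4, ∀ a b, a ∉ T → b ∉ T → X.Adj a b → c a ≠ c b) :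
    X.Colorable 4 := by
  classical
  induction T using Finset.induction_on with
  | empty =>
    obtain ⟨c, hc⟩ := hc
    exact ⟨Coloring.mk c fun h => hc _ _ (by simp) (by simp) h⟩
  | insert u T _ ih =>
    refine ih (fun v hv => hT v (Finset.mem_insert_of_mem hv)) ?_
    obtain ⟨c, hc⟩ := hc
    obtain ⟨p, q, r, hu⟩ := hT u (Finset.mem_insert_self _ _)
    -- Three forbidden colours leave one of the four free.
    obtain ⟨k, hp, hq, hr⟩ : ∃ k : Fin 4, k ≠ c p ∧ k ≠ c q ∧ k ≠ c r := by
      generalize c p = x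
      generalize c q = y
      generalize c r = z
      decide +revert
    have hk : ∀ w, X.Adj u w → k ≠ c w := by
      intro w hw
      rcases hu w hw with rfl | rfl | rfl <;> assumption
    refine ⟨Function.update c u k, fun a b ha hb hab => ?_⟩
    by_cases hau : a = u
    · subst hau
      simpa [Function.update_of_ne hab.ne'] using hk b hab
    · by_cases hbu : b = u
      · subst hbu
        simpa [Function.update_of_ne hab.ne] using (hk a hab.symm).symm
      · simpa [Function.update_of_ne hau, Function.update_of_ne hbu] using
          hc a b (by simp [hau, ha]) (by simp [hbu, hb]) hab

/-- The graph obtained from `G` by deleting all edges at the vertices of `T`. -/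
def isolate (G : SimpleGraph V) (T : Finset V) : SimpleGraph V where
  Adj a b := G.Adj a b ∧ a ∉ T ∧ b ∉ T
  symm := ⟨fun _ _ h => ⟨h.1.symm, h.2.2, h.2.1⟩⟩
  loopless := ⟨fun _ h => h.1.ne rfl⟩

theorem isolate_le (G : SimpleGraph V) (T : Finset V) : G.isolate T ≤ G := fun _ _ h => h.1

theorem isolate_lt {T : Finset V} {u v : V} (hu : u ∈ T) (huv : G.Adj u v) : G.isolate T < G :=
  lt_of_le_of_ne (G.isolate_le T) fun h => by
    rw [← h] at huv
    exact huv.2.1 hu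

/-- `hT` leaves a free colour at each vertex of `T`; `hcom` ensures that losing the edges at `T`
loses no constraint between vertices outside `T`. Isolating vertices rather than deleting them keeps
the vertex type fixed, so the induction can run on the order of subgraphs. -/
theorem colorable_exactSquare_of_isolate (T : Finset V)
    (hT : ∀ u ∈ T, ∃ p q r, ∀ m w, G.Adj u m → G.Adj m w → w ≠ u → ¬ G.Adj u w →
      w = p ∨ w = q ∨ w = r)
    (hcom : ∀ m ∈ T, ∀ a b, a ∉ T → b ∉ T → G.Adj m a → G.Adj m b → a ≠ b → ¬ G.Adj a b →
      ∃ m', m' ∉ T ∧ G.Adj a m' ∧ G.Adj b m')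
    (hc : (G.isolate T).exactSquare.Colorable 4) : G.exactSquare.Colorable 4 := by
  refine exists_coloring_of_coloring_compl T (fun u hu => ?_) ?_
  · obtain ⟨p, q, r, h⟩ := hT u hu
    refine ⟨p, q, r, fun w hw => ?_⟩
    obtain ⟨hne, hna, m, hmu, hmw⟩ := exactSquare_adj.1 hw
    exact h m w hmu.symm hmw hne.symm hna
  · obtain ⟨c⟩ := hc
    refine ⟨c, fun a b ha hb hab => c.valid ?_⟩
    obtain ⟨hne, hna, m, hma, hmb⟩ := exactSquare_adj.1 hab
    refine exactSquare_adj.2 ⟨hne, fun h => hna h.1, ?_⟩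
    by_cases hm : m ∈ T
    · obtain ⟨m', hm', h1, h2⟩ := hcom m hm a b ha hb hma hmb hne hna
      exact ⟨m', ⟨h1.symm, hm', ha⟩, ⟨h2.symm, hm', hb⟩⟩
    · exact ⟨m, ⟨hma, hm, ha⟩, ⟨hmb, hm, hb⟩⟩

theorem IsSubcubic.colorable_exactSquare [Finite V] (hs : G.IsSubcubic) (hG : G.IsK4MinorFree) :
    G.exactSquare.Colorable 4 := by
  classical
  induction G using WellFoundedLT.induction with
  | _ G ih =>
  have key : ∀ (T : Finset V) (u v : V), u ∈ T → G.Adj u v →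
      (G.isolate T).exactSquare.Colorable 4 :=
    fun T u v hu huv => ih _ (isolate_lt hu huv) (hs.mono (G.isolate_le T))
      (hG.mono (G.isolate_le T))
  by_cases hE : ∃ u v, G.Adj u v
  swap
  · refine ⟨Coloring.mk (fun _ => 0) fun {a b} h => ?_⟩
    obtain ⟨-, -, m, hm, -⟩ := exactSquare_adj.1 h
    exact absurd ⟨_, _, hm⟩ hE
  obtain ⟨u, v, huv⟩ := hE
  by_cases h1 : ∀ v a, G.Adj v a → ∃ w, G.Adj v w ∧ w ≠ a
  swap
  · push Not at h1
    obtain ⟨u, a, hua, hu⟩ := h1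
    obtain ⟨p, q, hpq⟩ := hs.exists_neighbors hua.symm
    refine colorable_exactSquare_of_isolate {u} ?_ ?_ (key _ u a (by simp) hua)
    · simp only [Finset.mem_singleton, forall_eq]
      refine ⟨p, q, q, fun m w hum hmw hwu _ => ?_⟩
      obtain rfl := hu m hum
      have := hpq w hmw
      tauto
    · simp only [Finset.mem_singleton, forall_eq]
      intro a b _ _ ha hb hab _
      exact absurd ((hu a ha).trans (hu b hb).symm) hab
  obtain ⟨u, x, y, hu, h⟩ := hG.exists_hasTwoNeighbors huv h1
  -- In a triangle, `x` and `y` are adjacent and impose no constraint on each other. In a 4-cycle,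
  -- `w` keeps them at distance two, and being shared it leaves only `w`, `p`, `q` to avoid. For
  -- adjacent vertices of degree two, both are isolated: each has only one neighbour outside `T`, so
  -- no pair is lost.
  rcases h with h | ⟨w, hwu, hxw, hyw⟩ | ⟨z, hx⟩
  · obtain ⟨p, hp⟩ := hs.exists_third_neighbor hu.left.symm h hu.right.ne'
    obtain ⟨q, hq⟩ := hs.exists_third_neighbor hu.right.symm h.symm hu.left.ne'
    refine colorable_exactSquare_of_isolate {u} ?_ ?_ (key _ u x (by simp) hu.left)
    · simp only [Finset.mem_singleton, forall_eq]
      refine ⟨p, q, q, fun m w hum hmw hwu huw => ?_⟩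
      have hwx : w ≠ x := fun h => huw (h ▸ hu.left)
      have hwy : w ≠ y := fun h => huw (h ▸ hu.right)
      rcases hu.eq_or_eq m hum with rfl | rfl
      · have := hp w hmw
        tauto
      · have := hq w hmw
        tauto
    · simp only [Finset.mem_singleton, forall_eq]
      intro a b _ _ ha hb hab hnab
      have := h.symm
      rcases hu.eq_or_eq a ha with rfl | rfl <;> rcases hu.eq_or_eq b hb with rfl | rfl <;>
        contradiction
  · obtain ⟨p, hp⟩ := hs.exists_third_neighbor hu.left.symm hxw hwu
    obtain ⟨q, hq⟩ := hs.exists_third_neighbor hu.right.symm hyw hwu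
    refine colorable_exactSquare_of_isolate {u} ?_ ?_ (key _ u x (by simp) hu.left)
    · simp only [Finset.mem_singleton, forall_eq]
      refine ⟨w, p, q, fun m w' hum hmw hwu huw => ?_⟩
      rcases hu.eq_or_eq m hum with rfl | rfl
      · have := hp w' hmw
        tauto
      · have := hq w' hmw
        tauto
    · simp only [Finset.mem_singleton, forall_eq]
      intro a b _ _ ha hb hab hnab
      refine ⟨w, hwu, ?_⟩
      rcases hu.eq_or_eq a ha with rfl | rfl <;> rcases hu.eq_or_eq b hb with rfl | rfl <;>
        first | contradiction | exact ⟨hxw, hyw⟩ | exact ⟨hyw, hxw⟩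
  · obtain ⟨p, q, hpq⟩ := hs.exists_neighbors hu.right.symm
    obtain ⟨p', q', hpq'⟩ := hs.exists_neighbors hx.right.symm
    refine colorable_exactSquare_of_isolate {u, x} ?_ ?_ (key _ u x (by simp) hu.left)
    · intro t ht
      rcases Finset.mem_insert.1 ht with rfl | ht
      · refine ⟨z, p, q, fun m w hm hmw hw _ => ?_⟩
        rcases hu.eq_or_eq m hm with rfl | rfl
        · have := hx.eq_or_eq w hmw
          tauto
        · have := hpq w hmw
          tauto
      · obtain rfl := Finset.mem_singleton.1 ht
        refine ⟨y, p', q', fun m w hm hmw hw _ => ?_⟩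
        rcases hx.eq_or_eq m hm with rfl | rfl
        · have := hu.eq_or_eq w hmw
          tauto
        · have := hpq' w hmw
          tauto
    · intro m hm a b ha hb hma hmb hab _
      simp only [Finset.mem_insert, Finset.mem_singleton, not_or] at hm ha hb
      rcases hm with rfl | rfl
      · have h1 := hu.eq_or_eq a hma
        have h2 := hu.eq_or_eq b hmb
        grind
      · have h1 := hx.eq_or_eq a hma
        have h2 := hx.eq_or_eq b hmb
        grind

/-! ### Certifying the absence of `K₄` minors -/

/-- A vertex `v` whose neighbors in the branch sets are among `x` and `y`, where `x` and `y` are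
equal or adjacent, can be removed from the branch sets of a `K₄` minor. -/
theorem exists_branchSets_diff_singleton {B : Fin 4 → Set V} {v x y : V}
    (hc : ∀ w, (G.induce (B w)).Connected) (hd : ∀ w w', w ≠ w' → Disjoint (B w) (B w'))
    (ha : ∀ w w', (completeGraph (Fin 4)).Adj w w' → ∃ x ∈ B w, ∃ y ∈ B w', G.Adj x y)
    (hv : ∀ w i, w ∈ B i → G.Adj v w → w = x ∨ w = y) (hxy : x = y ∨ G.Adj x y) :
    ∃ B' : Fin 4 → Set V, (∀ w, (G.induce (B' w)).Connected) ∧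
      (∀ w w', w ≠ w' → Disjoint (B' w) (B' w')) ∧
      (∀ w w', (completeGraph (Fin 4)).Adj w w' → ∃ x ∈ B' w, ∃ y ∈ B' w', G.Adj x y) ∧
      ∀ w, B' w ⊆ B w \ {v} := by
  have hdis : ∀ {i j z}, z ∈ B i → z ∈ B j → i = j := by
    intro i j z hi hj
    by_contra h
    exact Set.disjoint_left.1 (hd i j h) hi hj
  by_cases hvB : ∃ i, v ∈ B i
  swap
  · refine ⟨B, hc, hd, ha, fun w z hz => ⟨hz, ?_⟩⟩
    rintro rfl
    exact hvB ⟨w, hz⟩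
  obtain ⟨i, hi⟩ := hvB
  have hclose : ∀ m n j k, m ∈ B j → n ∈ B k → G.Adj v m → G.Adj v n → m = n ∨ G.Adj m n := by
    intro m n j k hm hn hvm hvn
    rcases hv m j hm hvm with rfl | rfl <;> rcases hv n k hn hvn with rfl | rfl
    · exact Or.inl rfl
    · exact hxy
    · exact hxy.imp Eq.symm fun h => h.symm
    · exact Or.inl rfl
  -- If `v` were alone in its branch set, the three other disjoint branch sets would each have to
  -- contain `x` or `y`.
  obtain ⟨n, hn, hvn⟩ : ∃ n ∈ B i, G.Adj v n := by
    by_contra hno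
    have hB : ∀ z ∈ B i, z = v := by
      intro z hz
      by_contra hzv
      obtain ⟨p⟩ := (hc i).preconnected ⟨v, hi⟩ ⟨z, hz⟩
      cases p with
      | nil => exact hzv rfl
      | @cons _ m _ h _ => exact hno ⟨m, m.2, h⟩
    have hout : ∀ j, i ≠ j → ∃ b ∈ B j, b = x ∨ b = y := by
      intro j hj
      obtain ⟨a, ha, b, hb, hab⟩ := ha i j hj
      rw [hB a ha] at hab
      exact ⟨b, hb, hv b j hb hab⟩
    obtain ⟨j, k, l, hj, hk, hl, hjk, hjl, hkl⟩ : ∃ j k l : Fin 4,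
        i ≠ j ∧ i ≠ k ∧ i ≠ l ∧ j ≠ k ∧ j ≠ l ∧ k ≠ l := by
      clear hout hB hno hi
      decide +revert
    obtain ⟨a, haj, ha'⟩ := hout j hj
    obtain ⟨b, hbk, hb'⟩ := hout k hk
    obtain ⟨c, hcl, hc'⟩ := hout l hl
    have hab : a ≠ b := fun h => hjk (hdis haj (h ▸ hbk))
    have hac : a ≠ c := fun h => hjl (hdis haj (h ▸ hcl))
    have hbc : b ≠ c := fun h => hkl (hdis hbk (h ▸ hcl))
    rcases ha' with rfl | rfl <;> rcases hb' with rfl | rfl <;> rcases hc' with rfl | rfl <;>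
      contradiction
  have hmem : ∀ {j z}, z ∈ B j → z ≠ v → z ∈ B j \ {v} := fun h h' => ⟨h, h'⟩
  refine ⟨fun j => B j \ {v}, fun j => ?_, fun j k h => (hd j k h).mono Set.sdiff_subset
    Set.sdiff_subset, ?_, fun _ => subset_rfl⟩
  · by_cases hij : i = j
    swap
    · change (G.induce (B j \ {v})).Connected
      rw [Set.sdiff_singleton_eq_self fun h => hij (hdis hi h)]
      exact hc j
    subst hij
    have hn' : n ∈ B i \ {v} := hmem hn hvn.ne'
    -- Walks are rerouted around `v` through `n`: a walk starting at `v` is treated as starting at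
    -- `n`, which equals or is adjacent to every neighbour of `v` in the branch set.
    have hwalk : ∀ (a b : B i), (G.induce (B i)).Walk a b →
        (∀ (hb : (b : V) ≠ v), ((∀ (ha : (a : V) ≠ v), (G.induce (B i \ {v})).Reachable
          ⟨a, hmem a.2 ha⟩ ⟨b, hmem b.2 hb⟩) ∧
        ((a : V) = v → (G.induce (B i \ {v})).Reachable ⟨n, hn'⟩ ⟨b, hmem b.2 hb⟩))) := by
      intro a b p
      induction p with
      | nil => exact fun hb => ⟨fun _ => Reachable.refl _, fun h => absurd h hb⟩
      | @cons a c b h p ih =>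
        intro hb
        have h : G.Adj a c := h
        have hto : ∀ (m : V) (hm : m ∈ B i) (hvm : G.Adj v m),
            (G.induce (B i \ {v})).Reachable ⟨n, hn'⟩ ⟨m, hmem hm hvm.ne'⟩ := by
          intro m hm hvm
          rcases hclose n m i i hn hm hvn hvm with h | h
          · subst h
            exact Reachable.refl _
          · exact Adj.reachable (G := G.induce (B i \ {v})) h
        constructor
        · intro hav
          by_cases hcv : (c : V) = v
          · exact (hto a a.2 (hcv ▸ h.symm)).symm.trans ((ih hb).2 hcv)
          · refine Reachable.trans (Adj.reachable (G := G.induce (B i \ {v})) ?_) ((ih hb).1 hcv)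
            exact h
        · intro hav
          have hcv : (c : V) ≠ v := fun hcv => h.ne (hav.trans hcv.symm)
          exact (hto c c.2 (hav ▸ h)).trans ((ih hb).1 hcv)
    refine (connected_iff _).2 ⟨?_, ⟨⟨n, hn'⟩⟩⟩
    rintro ⟨a, haB, hav⟩ ⟨b, hbB, hbv⟩
    obtain ⟨p⟩ := (hc i).preconnected ⟨a, haB⟩ ⟨b, hbB⟩
    exact (hwalk _ _ p hbv).1 hav
  · intro j k hjk
    obtain ⟨a, haj, b, hbk, hab⟩ := ha j k hjk
    have hne : j ≠ k := hjk
    by_cases hav : a = v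
    · subst hav
      obtain rfl := hdis hi haj
      refine ⟨n, hmem hn hvn.ne', b, hmem hbk hab.ne', ?_⟩
      refine (hclose n b i k hn hbk hvn hab).resolve_left ?_
      rintro rfl
      exact hne (hdis hn hbk)
    · by_cases hbv : b = v
      · subst hbv
        obtain rfl := hdis hi hbk
        refine ⟨a, hmem haj hav, n, hmem hn hvn.ne', ?_⟩
        refine (hclose a n j i haj hn hab.symm hvn).resolve_left ?_
        rintro rfl
        exact hne (hdis haj hn)
      · exact ⟨a, hmem haj hav, b, hmem hbk hbv, hab⟩

/-- A finite graph is `K₄`-minor-free if its vertices can be eliminated one after the other, each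
having at most two later neighbors at its elimination, which are adjacent. -/
theorem isK4MinorFree_of_elimination [Finite V] (r : V → ℕ) (hr : r.Injective) (p q : V → V)
    (h : ∀ v w, G.Adj v w → r v ≤ r w → w = p v ∨ w = q v)
    (hpq : ∀ v, p v = q v ∨ G.Adj (p v) (q v)) : G.IsK4MinorFree := by
  rintro ⟨B, hc, hd, ha⟩
  -- A minor can be pushed into the vertices of rank at least `k`, for every `k`; beyond the largest
  -- rank its branch sets would be empty.
  have key : ∀ k : ℕ, ∃ B : Fin 4 → Set V, (∀ w, (G.induce (B w)).Connected) ∧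
      (∀ w w', w ≠ w' → Disjoint (B w) (B w')) ∧
      (∀ w w', (completeGraph (Fin 4)).Adj w w' → ∃ x ∈ B w, ∃ y ∈ B w', G.Adj x y) ∧
      ∀ w, ∀ z ∈ B w, k ≤ r z := by
    intro k
    induction k with
    | zero => exact ⟨B, hc, hd, ha, fun _ _ _ => Nat.zero_le _⟩
    | succ k ih =>
      obtain ⟨B, hc, hd, ha, hB⟩ := ih
      by_cases hv : ∃ v, r v = k
      · obtain ⟨v, rfl⟩ := hv
        obtain ⟨B', hc', hd', ha', hB'⟩ := exists_branchSets_diff_singleton hc hd ha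
          (fun w i hw hvw => h v w hvw (hB i w hw)) (hpq v)
        refine ⟨B', hc', hd', ha', fun w z hz => ?_⟩
        obtain ⟨hz, hzv⟩ := hB' w hz
        exact lt_of_le_of_ne (hB w z hz) fun he => hzv (hr he).symm
      · push Not at hv
        exact ⟨B, hc, hd, ha, fun w z hz => lt_of_le_of_ne (hB w z hz) (hv z).symm⟩
  obtain ⟨K, hK⟩ := (Set.finite_range r).bddAbove
  obtain ⟨B', hc', -, -, hB'⟩ := key (K + 1)
  obtain ⟨⟨z, hz⟩⟩ := (hc' 0).nonempty
  have := hB' 0 z hz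
  have := hK ⟨z, rfl⟩
  omega

theorem isSubcubic_of_card_le [Fintype V] [DecidableRel G.Adj]
    (h : ∀ v, (Finset.univ.filter (G.Adj v)).card ≤ 3) : G.IsSubcubic := by
  intro v
  have : G.neighborSet v = (Finset.univ.filter (G.Adj v) : Finset V) := by
    ext
    simp
  rw [this, Set.encard_coe_eq_coe_finsetCard]
  exact_mod_cast h v

theorem exactSquareChromaticNumber_eq_four [Finite V] (hs : G.IsSubcubic)
    (hG : G.IsK4MinorFree) (h : ¬ G.exactSquare.Colorable 3) :
    G.exactSquareChromaticNumber = 4 := by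
  refine le_antisymm (chromaticNumber_le_iff_colorable.2 (hs.colorable_exactSquare hG)) ?_
  by_contra! hlt
  change G.exactSquare.chromaticNumber < (3 : ℕ) + 1 at hlt
  exact h (chromaticNumber_le_iff_colorable.1 (Order.le_of_lt_add_one hlt))

/-- The graph on `V` whose edges are listed in `l`. -/
def ofEdgeList (l : List (V × V)) : SimpleGraph V := fromRel fun a b => (a, b) ∈ l

instance [DecidableEq V] (l : List (V × V)) : DecidableRel (ofEdgeList l).Adj :=
  fun a b => inferInstanceAs (Decidable (a ≠ b ∧ ((a, b) ∈ l ∨ (b, a) ∈ l)))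

/-- The elimination is run in a supergraph `H` in which every vertex is joined to its images under
`p` and `q`, because the graph itself may lack the edges between later neighbours. The inequalities
are weak so that the last vertex can point to itself. -/
theorem isK4MinorFree_ofEdgeList [Finite V] (l : List (V × V)) (r : V → ℕ)
    (hr : r.Injective) (p q : V → V)
    (hl : ∀ e ∈ l, e.2 = p e.1 ∨ e.2 = q e.1 ∨ e.1 = p e.2 ∨ e.1 = q e.2)
    (hp : ∀ v, r v ≤ r (p v)) (hq : ∀ v, r v ≤ r (q v))
    (hpq : ∀ v, p v = q v ∨ q v = p (p v) ∨ q v = q (p v) ∨ p v = p (q v) ∨ p v = q (q v)) :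
    (ofEdgeList l).IsK4MinorFree := by
  let H : SimpleGraph V := fromRel fun a b => b = p a ∨ b = q a
  have hH : H.IsK4MinorFree := by
    refine isK4MinorFree_of_elimination r hr p q ?_ ?_
    · rintro v w ⟨hne, hvw | hvw⟩ hle
      · exact hvw
      · refine absurd (hr (le_antisymm hle ?_)) hne
        rcases hvw with rfl | rfl
        exacts [hp w, hq w]
    · intro v
      by_cases h : p v = q v
      · exact Or.inl h
      · have := hpq v
        exact Or.inr ⟨h, by tauto⟩
  refine hH.mono ?_
  rintro a b ⟨hne, h | h⟩
  · have := hl _ h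
    exact ⟨hne, by tauto⟩
  · have := hl _ h
    exact ⟨hne, by tauto⟩

/-! ### The bipartite example -/

/-- Two vertices of degree three joined by three paths of length three. -/
def thetaGraph : SimpleGraph (Fin 8) :=
  ofEdgeList [(0, 1), (1, 2), (2, 3), (0, 4), (4, 5), (5, 3), (0, 6), (6, 7), (7, 3)]

instance : DecidableRel thetaGraph.Adj := inferInstanceAs (DecidableRel (ofEdgeList _).Adj)

theorem isSubcubic_thetaGraph : thetaGraph.IsSubcubic := isSubcubic_of_card_le (by decide)

theorem isK4MinorFree_thetaGraph : thetaGraph.IsK4MinorFree :=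
  isK4MinorFree_ofEdgeList _ ![4, 0, 1, 5, 2, 3, 6, 7] (by decide) ![3, 0, 0, 6, 0, 0, 7, 7]
    ![6, 2, 3, 7, 5, 3, 7, 7] (by decide) (by decide) (by decide) (by decide)

theorem isBipartite_thetaGraph : thetaGraph.IsBipartite :=
  ⟨Coloring.mk ![0, 1, 0, 1, 1, 0, 1, 0] (by decide)⟩

/-- By bipartiteness cycles are even, so only length four must be excluded, by checking that
distinct vertices never have two common neighbours. -/
theorem six_le_egirth_thetaGraph : 6 ≤ thetaGraph.egirth := by
  rw [le_egirth]
  intro a w hw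
  have heven := two_colorable_iff_forall_loop_even.1 isBipartite_thetaGraph a w
  have h3 := hw.three_le_length
  have h4 : w.length ≠ 4 := by
    intro h4
    have hsq : ∀ a b, thetaGraph.Adj a b → ∀ c, thetaGraph.Adj b c → a ≠ c →
        ∀ d, thetaGraph.Adj c d → thetaGraph.Adj d a → b = d := by decide
    have hnd := hw.support_nodup
    match w, h4 with
    | .cons h1 (.cons h2 (.cons h3 (.cons h5 .nil))), _ =>
      simp only [Walk.support_cons, Walk.support_nil, List.tail_cons, List.nodup_cons,
        List.mem_cons, not_or] at hnd
      exact hnd.1.2.1 (hsq _ _ h1 _ h2 (Ne.symm hnd.2.1.2.1) _ h3 h5)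
  have : 6 ≤ w.length := by
    obtain ⟨k, hk⟩ := heven
    omega
  exact_mod_cast this

/-- The branch vertex `0` and the three neighbours `2`, `5`, `7` of the other branch vertex are
pairwise at distance two. -/
theorem not_colorable_exactSquare_thetaGraph : ¬ thetaGraph.exactSquare.Colorable 3 := by
  rintro ⟨c⟩
  have hc : ∀ u v, (u ≠ v ∧ ¬ thetaGraph.Adj u v ∧ ∃ w, thetaGraph.Adj w u ∧ thetaGraph.Adj w v) →
      c u ≠ c v := fun u v h => c.valid (exactSquare_adj.2 h)
  have h1 := hc 0 2 (by decide)
  have h2 := hc 0 5 (by decide)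
  have h3 := hc 0 7 (by decide)
  have h4 := hc 2 5 (by decide)
  have h5 := hc 2 7 (by decide)
  have h6 := hc 5 7 (by decide)
  omega

/-! ### The outerplanar example -/

/-- An outerplanar graph consisting of a heptagon and three pentagons, one of them sharing an edge
with the heptagon and the other two joined to it through quadrilaterals. -/
def pentagonGraph : SimpleGraph (Fin 20) :=
  ofEdgeList [(0, 1), (0, 14), (0, 19), (1, 2), (2, 3), (2, 8), (3, 4), (3, 7), (4, 5), (5, 6),
    (6, 7), (7, 8), (8, 9), (9, 10), (9, 13), (10, 11), (11, 12), (12, 13), (13, 14), (14, 15),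
    (15, 16), (15, 19), (16, 17), (17, 18), (18, 19)]

instance : DecidableRel pentagonGraph.Adj := inferInstanceAs (DecidableRel (ofEdgeList _).Adj)

set_option maxRecDepth 10000 in
theorem isSubcubic_pentagonGraph : pentagonGraph.IsSubcubic :=
  isSubcubic_of_card_le (by decide)

set_option maxRecDepth 10000 in
theorem isK4MinorFree_pentagonGraph : pentagonGraph.IsK4MinorFree :=
  isK4MinorFree_ofEdgeList _
    ![13, 0, 6, 4, 1, 2, 3, 5, 7, 11, 8, 9, 10, 12, 14, 15, 16, 17, 18, 19] (by decide)
    -- With the next vector, this triangulates the inner faces.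
    ![14, 0, 0, 2, 3, 3, 3, 2, 0, 0, 9, 9, 9, 0, 15, 16, 17, 18, 19, 19]
    ![19, 2, 8, 7, 5, 6, 7, 8, 9, 13, 11, 12, 13, 14, 19, 19, 19, 19, 19, 19]
    (by decide) (by decide) (by decide) (by decide)

/-- With three colours, two vertices that both avoid the same two distinct colours agree. The two
pentagons behind quadrilaterals thus force `9` and `13` to differ in colour from `1`. In the
remaining pentagon, `10` and `12` must then both take the colour of `1`, although they are at
distance two. -/
theorem not_colorable_exactSquare_pentagonGraph : ¬ pentagonGraph.exactSquare.Colorable 3 := by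
  rintro ⟨c⟩
  have hc : ∀ u v, (u ≠ v ∧ ¬ pentagonGraph.Adj u v ∧
      ∃ w, pentagonGraph.Adj w u ∧ pentagonGraph.Adj w v) →
      c u ≠ c v := fun u v h => c.valid (exactSquare_adj.2 h)
  have third : ∀ {a b x y : Fin 3}, a ≠ b → x ≠ a → x ≠ b → y ≠ a → y ≠ b → x = y := by decide
  have h94 : c 9 = c 4 := third (hc 2 7 (by decide)) (hc 9 2 (by decide)) (hc 9 7 (by decide))
    (hc 4 2 (by decide)) (hc 4 7 (by decide))
  have h16 : c 1 = c 6 := third (hc 3 8 (by decide)) (hc 1 3 (by decide)) (hc 1 8 (by decide))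
    (hc 6 3 (by decide)) (hc 6 8 (by decide))
  have h91 : c 9 ≠ c 1 := by
    rw [h94, h16]
    exact hc 4 6 (by decide)
  have h1318 : c 13 = c 18 := third (hc 0 15 (by decide)) (hc 13 0 (by decide))
    (hc 13 15 (by decide)) (hc 18 0 (by decide)) (hc 18 15 (by decide))
  have h116 : c 1 = c 16 := third (hc 14 19 (by decide)) (hc 1 14 (by decide))
    (hc 1 19 (by decide)) (hc 16 14 (by decide)) (hc 16 19 (by decide))
  have h131 : c 13 ≠ c 1 := by
    rw [h1318, h116]
    exact hc 18 16 (by decide)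
  have h10 : c 10 = c 1 := third (hc 8 13 (by decide)) (hc 10 8 (by decide))
    (hc 10 13 (by decide)) (hc 1 8 (by decide)) h131.symm
  have h12 : c 12 = c 1 := third (hc 9 14 (by decide)) (hc 12 9 (by decide))
    (hc 12 14 (by decide)) h91.symm (hc 1 14 (by decide))
  exact hc 10 12 (by decide) (h10.trans h12.symm)

/-! ### Outerplanar drawings by chords of a parabola -/

/-- The point of the parabola `y = x ^ 2` with first coordinate `x`. -/
noncomputable def parabolaPoint (x : ℝ) : EuclideanSpace ℝ (Fin 2) := !₂[x, x ^ 2]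

theorem mem_segment_parabolaPoint {a b : ℝ} (hab : a ≤ b) {z : EuclideanSpace ℝ (Fin 2)}
    (hz : z ∈ segment ℝ (parabolaPoint a) (parabolaPoint b)) :
    a ≤ z 0 ∧ z 0 ≤ b ∧ z 1 = z 0 ^ 2 + (z 0 - a) * (b - z 0) := by
  rw [segment_eq_image_lineMap] at hz
  obtain ⟨t, ⟨ht0, ht1⟩, rfl⟩ := hz
  have h0 : (AffineMap.lineMap (parabolaPoint a) (parabolaPoint b) t :
      EuclideanSpace ℝ (Fin 2)) 0 = t * (b - a) + a := by
    simp [AffineMap.lineMap_apply, parabolaPoint]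
  have h1 : (AffineMap.lineMap (parabolaPoint a) (parabolaPoint b) t :
      EuclideanSpace ℝ (Fin 2)) 1 = t * (b ^ 2 - a ^ 2) + a ^ 2 := by
    simp [AffineMap.lineMap_apply, parabolaPoint]
  rw [h0, h1]
  refine ⟨?_, ?_, by ring⟩ <;> nlinarith

theorem eq_parabolaPoint {z : EuclideanSpace ℝ (Fin 2)} (h : z 1 = z 0 ^ 2) :
    z = parabolaPoint (z 0) := by
  ext i
  fin_cases i
  · simp [parabolaPoint]
  · simpa [parabolaPoint] using h

/-- `(x - a) * (b - x)` is the height of the chord over `[a, b]` above the parabola. At a common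
point the heights agree. If they vanish, the point is an end of both chords; if they are positive,
the non-crossing intervals are nested and the larger one gives a strictly higher chord. -/
theorem eq_ends_of_noncrossing {a b c d x : ℝ} (hax : a ≤ x) (hxb : x ≤ b) (hcx : c ≤ x)
    (hxd : x ≤ d) (h : (x - a) * (b - x) = (x - c) * (d - x))
    (h₁ : ¬ (a < c ∧ c < b ∧ b < d)) (h₂ : ¬ (c < a ∧ a < d ∧ d < b)) (hne : ¬ (a = c ∧ b = d)) :
    (x = a ∨ x = b) ∧ (x = c ∨ x = d) := by
  by_cases h0 : (x - a) * (b - x) = 0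
  · have h0' := h ▸ h0
    rw [mul_eq_zero, sub_eq_zero, sub_eq_zero] at h0 h0'
    exact ⟨h0.imp_right Eq.symm, h0'.imp_right Eq.symm⟩
  exfalso
  have h0' := h ▸ h0
  have ha : 0 < x - a := lt_of_le_of_ne (by linarith) fun h => h0 (by rw [← h, zero_mul])
  have hb : 0 < b - x := lt_of_le_of_ne (by linarith) fun h => h0 (by rw [← h, mul_zero])
  have hc : 0 < x - c := lt_of_le_of_ne (by linarith) fun h => h0' (by rw [← h, zero_mul])
  have hd : 0 < d - x := lt_of_le_of_ne (by linarith) fun h => h0' (by rw [← h, mul_zero])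
  rcases lt_trichotomy a c with hac | rfl | hac
  · have hbd : d ≤ b := by
      by_contra! hbd
      exact h₁ ⟨hac, by linarith, hbd⟩
    nlinarith
  · exact hne ⟨rfl, by nlinarith [mul_left_cancel₀ ha.ne' h]⟩
  · have hbd : b ≤ d := by
      by_contra! hbd
      exact h₂ ⟨hac, by linarith, hbd⟩
    nlinarith

/-- The drawing of `G` with vertices on a parabola and straight edges. -/
noncomputable def parabolaDrawing (G : SimpleGraph V) (x : V → ℝ) (hx : x.Injective)
    (hG : ∀ a b c d, G.Adj a b → G.Adj c d → x a < x c → x c < x b → ¬ x b < x d) :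
    G.PlaneDrawing where
  pt v := parabolaPoint (x v)
  -- Orienting the edge from left to right makes the height formula applicable.
  arc e := {z | ∃ u v, e = s(u, v) ∧ x u ≤ x v ∧
    z ∈ segment ℝ (parabolaPoint (x u)) (parabolaPoint (x v))}
  pt_injective u v h := hx (by simpa [parabolaPoint] using congrArg (fun z => z 0) h)
  arc_eq_range u v huv := by
    have hne : parabolaPoint (x u) ≠ parabolaPoint (x v) := fun h =>
      huv.ne (hx (by simpa [parabolaPoint] using congrArg (fun z => z 0) h))
    refine ⟨⟨⟨fun t => AffineMap.lineMap (parabolaPoint (x u)) (parabolaPoint (x v)) (t : ℝ),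
      AffineMap.lineMap_continuous.comp continuous_subtype_val⟩, by simp, by simp⟩, ?_, ?_⟩
    · exact (AffineMap.lineMap_injective ℝ hne).comp Subtype.val_injective
    · have hr : Set.range (fun t : unitInterval => AffineMap.lineMap (k := ℝ)
          (parabolaPoint (x u)) (parabolaPoint (x v)) (t : ℝ)) =
          segment ℝ (parabolaPoint (x u)) (parabolaPoint (x v)) := by
        rw [segment_eq_image_lineMap, Set.image_eq_range]
      refine hr.trans (Set.ext fun z => ⟨fun hz => ?_, ?_⟩)
      · rcases le_total (x u) (x v) with h | h
        · exact ⟨u, v, rfl, h, hz⟩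
        · exact ⟨v, u, Sym2.eq_swap, h, by rwa [segment_symm]⟩
      · rintro ⟨a, b, hab, -, hz⟩
        rcases Sym2.eq_iff.1 hab with ⟨rfl, rfl⟩ | ⟨rfl, rfl⟩
        · exact hz
        · rwa [segment_symm]
  mem_of_pt_mem_arc := by
    rintro e - v ⟨a, b, rfl, hab, hz⟩
    obtain ⟨-, -, h⟩ := mem_segment_parabolaPoint hab hz
    have h : (x v - x a) * (x b - x v) = 0 := by simpa [parabolaPoint] using h
    rw [mul_eq_zero, sub_eq_zero, sub_eq_zero] at h
    rcases h with h | h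
    · simp [hx h]
    · simp [hx h]
  arc_inter_arc := by
    rintro e he e' he' hne z ⟨⟨a, b, rfl, hab, hz⟩, ⟨c, d, rfl, hcd, hz'⟩⟩
    rw [mem_edgeSet] at he he'
    obtain ⟨h1, h2, h3⟩ := mem_segment_parabolaPoint hab hz
    obtain ⟨h1', h2', h3'⟩ := mem_segment_parabolaPoint hcd hz'
    obtain ⟨h4, h5⟩ := eq_ends_of_noncrossing h1 h2 h1' h2' (by linarith)
      (fun h => hG a b c d he he' h.1 h.2.1 h.2.2) (fun h => hG c d a b he' he h.1 h.2.1 h.2.2)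
      (fun h => hne (by rw [hx h.1, hx h.2]))
    have hz : z = parabolaPoint (z 0) := by
      refine eq_parabolaPoint ?_
      rcases h4 with h4 | h4 <;> rw [h3, ← h4] <;> ring
    have hex : ∃ v, (v = a ∨ v = b) ∧ (v = c ∨ v = d) ∧ z 0 = x v := by
      rcases h4 with h4 | h4 <;> rcases h5 with h5 | h5
      · exact ⟨a, Or.inl rfl, Or.inl (hx (h4.symm.trans h5)), h4⟩
      · exact ⟨a, Or.inl rfl, Or.inr (hx (h4.symm.trans h5)), h4⟩
      · exact ⟨b, Or.inr rfl, Or.inl (hx (h4.symm.trans h5)), h4⟩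
      · exact ⟨b, Or.inr rfl, Or.inr (hx (h4.symm.trans h5)), h4⟩
    obtain ⟨v, hv, hv', hzv⟩ := hex
    exact ⟨v, ⟨by simpa using hv, by simpa using hv'⟩, by rw [hz, hzv]⟩

theorem isPreconnected_below_parabola :
    IsPreconnected {z : EuclideanSpace ℝ (Fin 2) | z 1 < z 0 ^ 2} := by
  have h : {z : EuclideanSpace ℝ (Fin 2) | z 1 < z 0 ^ 2} =
      (fun w : ℝ × ℝ => (!₂[w.1, w.1 ^ 2 - w.2] : EuclideanSpace ℝ (Fin 2))) ''
        (Set.univ ×ˢ Set.Ioi 0) := by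
    ext z
    constructor
    · intro (hz : z 1 < z 0 ^ 2)
      refine ⟨(z 0, z 0 ^ 2 - z 1), ⟨trivial, sub_pos.2 hz⟩, ?_⟩
      ext i
      fin_cases i <;> simp
    · rintro ⟨w, ⟨-, hw⟩, rfl⟩
      have hw : 0 < w.2 := hw
      simpa using hw
  rw [h]
  refine (isPreconnected_univ.prod isPreconnected_Ioi).image _ (Continuous.continuousOn ?_)
  refine (PiLp.continuous_toLp 2 _).comp (continuous_pi fun i => ?_)
  fin_cases i
  · exact continuous_fst
  · exact (continuous_fst.pow 2).sub continuous_snd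

/-- A graph that can be drawn without crossings by chords of a parabola is outerplanar. -/
theorem isOuterplanar_of_noncrossing (x : V → ℝ) (hx : x.Injective)
    (hG : ∀ a b c d, G.Adj a b → G.Adj c d → x a < x c → x c < x b → ¬ x b < x d) :
    G.IsOuterplanar := by
  set D := G.parabolaDrawing x hx hG with hD
  have hsup : {z : EuclideanSpace ℝ (Fin 2) | z 1 < z 0 ^ 2} ⊆ D.supportᶜ := by
    intro z (hz : z 1 < z 0 ^ 2) hzD
    rcases hzD with ⟨v, rfl⟩ | hzD
    · simp [hD, parabolaDrawing, parabolaPoint] at hz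
    · simp only [Set.mem_iUnion] at hzD
      obtain ⟨e, -, a, b, -, hab, hz'⟩ := hzD
      obtain ⟨h1, h2, h3⟩ := mem_segment_parabolaPoint hab hz'
      nlinarith [mul_nonneg (sub_nonneg.2 h1) (sub_nonneg.2 h2)]
  have hbelow : ∀ s t : ℝ, 0 < t → (!₂[s, s ^ 2 - t] : EuclideanSpace ℝ (Fin 2)) ∈
      {z : EuclideanSpace ℝ (Fin 2) | z 1 < z 0 ^ 2} := by
    intro s t ht
    simpa using ht
  have h0 := hbelow 0 1 one_pos
  have hF := isPreconnected_below_parabola.subset_connectedComponentIn h0 hsup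
  -- Chords lie on or above the parabola, so the connected region strictly below it lies in a single
  -- face. That region is unbounded and approaches every vertex vertically from below.
  refine ⟨D, _, ⟨_, hsup h0, rfl⟩, fun hb => ?_, fun v => ⟨?_, fun hv => ?_⟩⟩
  · obtain ⟨R, hR⟩ := hb.exists_norm_le
    have h1 := hR _ (hF (hbelow (R + 1) 1 one_pos))
    have h2 := (PiLp.norm_apply_le
      (!₂[R + 1, (R + 1) ^ 2 - 1] : EuclideanSpace ℝ (Fin 2)) 0).trans h1
    have h3 := (le_abs_self _).trans h2
    simp at h3
    linarith
  · refine closure_mono hF ?_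
    have ht : Filter.Tendsto (fun t : ℝ => (!₂[x v, x v ^ 2 - t] : EuclideanSpace ℝ (Fin 2)))
        (nhdsWithin 0 (Set.Ioi 0)) (nhds (D.pt v)) := by
      have hc : Continuous fun t : ℝ => (!₂[x v, x v ^ 2 - t] : EuclideanSpace ℝ (Fin 2)) := by
        refine (PiLp.continuous_toLp 2 _).comp (continuous_pi fun i => ?_)
        fin_cases i
        · exact continuous_const
        · exact continuous_const.sub continuous_id
      have := hc.tendsto 0
      rw [sub_zero] at this
      exact this.mono_left nhdsWithin_le_nhds
    exact mem_closure_of_tendsto ht (Filter.eventually_of_mem self_mem_nhdsWithin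
      fun t ht => hbelow _ _ ht)
  · exact connectedComponentIn_subset _ _ (interior_subset hv) (Or.inl ⟨v, rfl⟩)

theorem isOuterplanar_ofEdgeList {n : ℕ} (l : List (Fin n × Fin n))
    (hlt : ∀ e ∈ l, e.1 < e.2)
    (hl : ∀ e ∈ l, ∀ e' ∈ l, ¬ (e.1 < e'.1 ∧ e'.1 < e.2 ∧ e.2 < e'.2)) :
    (ofEdgeList l).IsOuterplanar := by
  refine isOuterplanar_of_noncrossing (fun i => ((i : ℕ) : ℝ)) (fun i j h => ?_) ?_
  · exact Fin.ext (Nat.cast_injective h)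
  · intro a b c d hab hcd hac hcb hbd
    have hac : a < c := by exact_mod_cast hac
    have hcb : c < b := by exact_mod_cast hcb
    have hbd : b < d := by exact_mod_cast hbd
    have h1 : (a, b) ∈ l := hab.2.resolve_right fun h => (hlt _ h).not_gt (hac.trans hcb)
    have h2 : (c, d) ∈ l := hcd.2.resolve_right fun h => (hlt _ h).not_gt (hcb.trans hbd)
    exact hl _ h1 _ h2 ⟨hac, hcb, hbd⟩

set_option maxRecDepth 10000 in
theorem isOuterplanar_pentagonGraph : pentagonGraph.IsOuterplanar :=
  isOuterplanar_ofEdgeList _ (by decide) (by decide)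

end SimpleGraph

theorem mainTheorem3 :
    (∀ (V : Type*) [Finite V] (G : SimpleGraph V),
      G.IsSubcubic → G.IsK4MinorFree → G.exactSquareChromaticNumber ≤ 4) ∧
    (∃ (n : ℕ) (G : SimpleGraph (Fin n)),
      G.IsBipartite ∧ G.IsSubcubic ∧ G.IsK4MinorFree ∧ 6 ≤ G.egirth ∧
        G.exactSquareChromaticNumber = 4) ∧
    (∃ (n : ℕ) (G : SimpleGraph (Fin n)),
      G.IsOuterplanar ∧ G.IsSubcubic ∧ G.IsK4MinorFree ∧
        G.exactSquareChromaticNumber = 4) := by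
  open SimpleGraph in
  exact ⟨fun V _ G hs hG => chromaticNumber_le_iff_colorable.2 (hs.colorable_exactSquare hG),
    ⟨8, thetaGraph, isBipartite_thetaGraph, isSubcubic_thetaGraph, isK4MinorFree_thetaGraph,
      six_le_egirth_thetaGraph, exactSquareChromaticNumber_eq_four isSubcubic_thetaGraph
        isK4MinorFree_thetaGraph not_colorable_exactSquare_thetaGraph⟩,
    ⟨20, pentagonGraph, isOuterplanar_pentagonGraph, isSubcubic_pentagonGraph,
      isK4MinorFree_pentagonGraph, exactSquareChromaticNumber_eq_four isSubcubic_pentagonGraph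
        isK4MinorFree_pentagonGraph not_colorable_exactSquare_pentagonGraph⟩⟩
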